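/- Let $n, m \ge 1$ and let $A \in \mathbb{C}^{n\times n}$ be a normal matrix with spectral norm $\|A\| \le 1$ and eigendecomposition $A = \sum_{j=1}^n \lambda_j v_j v_j^*$, where $v_1,\dots,v_n$ is an orthonormal basis of $\mathbb{C}^n$. Let \[ \mu_A = \frac1n \sum_{j=1}^n \delta_{\lambda_j}, \qquad \mu_{A,b} = \sum_{j=1}^n |b^* v_j|^2\, \delta_{\lambda_j} \] be the spectral density of $A$ and its weighted spectral density with respect to a unit vector $b \in \mathbb{C}^n$. Let $T_j$ be the $j$th Chebyshev polynomial of the first kind, $\widetilde T_0 = 1/\sqrt{\pi}$ and $\widetilde T_j = \sqrt{2/\pi}\, T_j$ for $j \ge 1$, and let \[ \Gamma_{jk} = \int \widetilde T_j(x)\widetilde T_k(y)\, d\mu_A(x+iy), \qquad \Gamma'_{jk} = \int \widetilde T_j(x)\widetilde T_k(y)\, d\mu_{A,b}(x+iy), \qquad 0 \le j,k \le m, \] be the mixed Chebyshev moments of $\mu_A$ and $\mu_{A,b}$. If $b$ is uniformly distributed on the unit sphere of $\mathbb{C}^n$ (identified with $S^{2n-1} \subset \mathbb{R}^{2n}$),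 then for every $0 < \delta < 1$, \[ \mathbb{P}\left( \max_{\substack{0\le j,k\le m\\ (j,k)\neq(0,0)}} |\Gamma_{jk} - \Gamma'_{jk}| \ge \sqrt{\frac{8}{2n-1}\log\left(\frac{2(m+1)^2-2}{\delta}\right)} \right) \le \delta . \] -/

import Mathlib

open MeasureTheory ProbabilityTheory
open scoped ENNReal Matrix

noncomputable section

namespace SpectralDensity

/-- `ℂⁿ` with its Euclidean norm. -/
abbrev CVec (n : ℕ) : Type := EuclideanSpace ℂ (Fin n)

/-- The unit sphere of `ℂⁿ`, i.e. the sphere `S^{2n-1}` of `ℝ^{2n}`. -/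
abbrev CSphere (n : ℕ) : Set (CVec n) := Metric.sphere (0 : CVec n) 1

/-- The uniform distribution on the unit sphere of `ℂⁿ`: the surface measure induced by Lebesgue
measure on `ℂⁿ = ℝ^{2n}`, normalized to total mass one. -/
def uniformSphere (n : ℕ) : Measure (CSphere n) :=
  ((volume : Measure (CVec n)).toSphere Set.univ)⁻¹ • (volume : Measure (CVec n)).toSphere

/-- The spectral density `μ_A = (1/n) ∑ⱼ δ_{λⱼ}`, the `λⱼ` being the eigenvalues of `A` repeated
according to multiplicity. -/
def spectralMeasure {n : ℕ} (A : Matrix (Fin n) (Fin n) ℂ) : Measure ℂ :=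
  (n : ℝ≥0∞)⁻¹ • (A.charpoly.roots.map fun z => Measure.dirac z).sum

/-- An eigendecomposition `A = ∑ⱼ λⱼ vⱼ vⱼ*` with an orthonormal basis of eigenvectors. -/
structure Eigendecomposition {n : ℕ} (A : Matrix (Fin n) (Fin n) ℂ) where
  /-- the eigenvalues `λⱼ` -/
  val : Fin n → ℂ
  /-- the eigenvectors `vⱼ` -/
  vec : OrthonormalBasis (Fin n) ℂ (CVec n)
  eq_sum : A = ∑ j, val j • Matrix.vecMulVec (vec j) (star (vec j : Fin n → ℂ))

/-- The weighted spectral density `μ_{A,b} = ∑ⱼ |b* vⱼ|² δ_{λⱼ}`. -/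
def Eigendecomposition.weightedMeasure {n : ℕ} {A : Matrix (Fin n) (Fin n) ℂ}
    (D : Eigendecomposition A) (b : CVec n) : Measure ℂ :=
  ∑ j, ENNReal.ofReal (‖inner ℂ b (D.vec j)‖ ^ 2) • Measure.dirac (D.val j)

/-- Every normal matrix has an eigendecomposition. -/
theorem nonempty_eigendecomposition {n : ℕ} (A : Matrix (Fin n) (Fin n) ℂ)
    (hA : IsStarNormal A) : Nonempty (Eigendecomposition A) := by
  classical
  have hAA : Aᴴ * A = A * Aᴴ := hA.star_comm_self
  let H : Matrix (Fin n) (Fin n) ℂ := A + Aᴴ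
  let K : Matrix (Fin n) (Fin n) ℂ := Complex.I • (A - Aᴴ)
  have hH : (Matrix.toEuclideanLin H).IsSymmetric := by
    rw [Matrix.isSymmetric_toEuclideanLin_iff]
    simp [Matrix.IsHermitian, H, add_comm]
  have hK : (Matrix.toEuclideanLin K).IsSymmetric := by
    rw [Matrix.isSymmetric_toEuclideanLin_iff]
    simp [Matrix.IsHermitian, K, smul_sub]
    abel
  have hHK : Commute (Matrix.toEuclideanLin H) (Matrix.toEuclideanLin K) := by
    have h : H * K = K * H := by
      simp only [H, K, mul_smul_comm, smul_mul_assoc]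
      congr 1
      simp only [add_mul, mul_sub, sub_mul, mul_add, hAA]
      abel
    ext v i
    have := congrArg (fun M => (M *ᵥ v.ofLp) i) h
    simpa [Matrix.toLpLin_apply, Matrix.mulVec_mulVec] using this
  have hint := LinearMap.IsSymmetric.directSum_isInternal_of_commute hH hK hHK
  have hort := LinearMap.IsSymmetric.orthogonalFamily_eigenspace_inf_eigenspace hH hK
  set V : ℂ × ℂ → Submodule ℂ (CVec n) := fun i =>
    Module.End.eigenspace (Matrix.toEuclideanLin H) i.2 ⊓
      Module.End.eigenspace (Matrix.toEuclideanLin K) i.1 with hV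
  have hfin : Finite {i // V i ≠ ⊥} :=
    WellFoundedGT.finite_ne_bot_of_iSupIndep hint.submodule_iSupIndep
  have := Fintype.ofFinite {i // V i ≠ ⊥}
  have hint' := DirectSum.isInternal_ne_bot_iff.mpr hint
  have hort' := hort.comp (Subtype.val_injective (p := fun i => V i ≠ ⊥))
  have hdim : Module.finrank ℂ (CVec n) = n := by simp
  let v := hint'.subordinateOrthonormalBasis hdim hort'
  let ix : Fin n → ℂ × ℂ := fun j =>
    (hint'.subordinateOrthonormalBasisIndex hdim j hort' : {i // V i ≠ ⊥})
  have hmem : ∀ j, v j ∈ V (ix j) := fun j =>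
    hint'.subordinateOrthonormalBasis_subordinate hdim j hort'
  let val : Fin n → ℂ := fun j => ((ix j).2 - Complex.I * (ix j).1) / 2
  have heig : ∀ j, A *ᵥ (v j).ofLp = val j • (v j).ofLp := by
    intro j
    obtain ⟨h1, h2⟩ := hmem j
    rw [SetLike.mem_coe, Module.End.mem_eigenspace_iff] at h1 h2
    ext i
    have e1 := congrArg (fun w : CVec n => w i) h1
    have e2 := congrArg (fun w : CVec n => w i) h2
    simp [Matrix.toLpLin_apply, H, K] at e1 e2
    simp only [Pi.smul_apply, smul_eq_mul, val]
    have hI := Complex.I_mul_I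
    linear_combination (1 / 2) * e1 - (Complex.I / 2) * e2
      + ((A *ᵥ (v j).ofLp) i - (Aᴴ *ᵥ (v j).ofLp) i) / 2 * hI
  refine ⟨⟨val, v, ?_⟩⟩
  apply Matrix.toEuclideanLin.injective
  apply v.toBasis.ext
  intro k
  ext i
  have hdot : ∀ j, star (v j).ofLp ⬝ᵥ (v k).ofLp = if j = k then 1 else 0 := by
    intro j
    have := orthonormal_iff_ite.mp v.orthonormal j k
    rwa [EuclideanSpace.inner_eq_star_dotProduct, dotProduct_comm] at this
  simp [Matrix.toLpLin_apply, heig, Matrix.vecMulVec_mulVec, hdot, ite_apply]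

/-- The normalized Chebyshev polynomials of the first kind,
`T̃₀ = 1/√π` and `T̃ⱼ = √(2/π) Tⱼ` for `j ≥ 1`, as functions on `ℝ`. -/
def chebT (j : ℕ) (x : ℝ) : ℝ :=
  if j = 0 then 1 / √Real.pi else √(2 / Real.pi) * (Polynomial.Chebyshev.T ℝ j).eval x

/-- The `(j,k)` mixed Chebyshev moment `∫ T̃ⱼ(x) T̃ₖ(y) dμ(x + iy)`. -/
def chebMoment (μ : Measure ℂ) (j k : ℕ) : ℝ :=
  ∫ z, chebT j z.re * chebT k z.im ∂μ

/-- The index pairs `0 ≤ j, k ≤ m` with `(j,k) ≠ (0,0)`. -/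
def momentIndices (m : ℕ) : Finset (ℕ × ℕ) :=
  (Finset.range (m + 1) ×ˢ Finset.range (m + 1)).erase (0, 0)

theorem momentIndices_nonempty {m : ℕ} (hm : 1 ≤ m) : (momentIndices m).Nonempty :=
  ⟨(0, 1), by simp [momentIndices]; omega⟩

/-- The largest difference `max_{(j,k) ≠ 0} |Γⱼₖ - Γ'ⱼₖ|` between the nonconstant mixed Chebyshev
moments up to degree `m` of `μ` and `ν`. -/
def maxMomentDiff {m : ℕ} (hm : 1 ≤ m) (μ ν : Measure ℂ) : ℝ :=
  (momentIndices m).sup' (momentIndices_nonempty hm)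
    fun p => |chebMoment μ p.1 p.2 - chebMoment ν p.1 p.2|

end SpectralDensity

end

namespace SpectralDensity

/-! ### Moments of the spectral measures -/

/-! Fix a pair (j,k), let `a i` be the value of T̃ⱼ(x)T̃ₖ(y) at the i-th eigenvalue x + iy, and put
wᵢ = |⟨b,vᵢ⟩|². Then Γ' = ∑ aᵢwᵢ is a quadratic form on the sphere and Γ is the plain average of the
aᵢ. Since ‖A‖ ≤ 1 confines the spectrum to the unit disc, |aᵢ| ≤ 2/π.

The form is concentrated by a Chernoff argument carried out on Gaussian integrals
(`uniformSphere_upper_tail`). On the bad event the form ∑ βᵢ|⟨x,vᵢ⟩|², for suitable βᵢ > 0, is at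
most ‖x‖² throughout the cone over the event. By polar coordinates (`uniformSphere_le_of_gaussian`)
the probability is then at most the ratio of the two Gaussian integrals, ∏ βᵢ⁻¹, which
`prod_div_one_sub_le_exp` bounds by exp(-nε²/4). Two tails and a union bound over the (m+1)² - 1
pairs finish the proof. -/

theorem Eigendecomposition.charpoly_eq {n : ℕ} {A : Matrix (Fin n) (Fin n) ℂ}
    (D : Eigendecomposition A) :
    A.charpoly = ∏ j, (Polynomial.X - Polynomial.C (D.val j)) := by
  let U : Matrix (Fin n) (Fin n) ℂ := Matrix.of fun i j => D.vec j i
  have hU : Uᴴ * U = 1 := by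
    ext i j
    have h := orthonormal_iff_ite.mp D.vec.orthonormal i j
    rw [PiLp.inner_apply] at h
    rw [Matrix.mul_apply, Matrix.one_apply, ← h]
    exact Finset.sum_congr rfl fun k _ => by simp [U, mul_comm]
  have hA : A = U * Matrix.diagonal D.val * Uᴴ := by
    refine D.eq_sum.trans ?_
    ext i j
    rw [Matrix.mul_apply, Matrix.sum_apply]
    exact Finset.sum_congr rfl fun k _ => by
      simp [U, Matrix.vecMulVec_apply, Matrix.mul_diagonal]; ring
  rw [congrArg Matrix.charpoly hA, Matrix.charpoly_mul_comm, ← mul_assoc, hU, one_mul, Matrix.charpoly_diagonal]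

/-- Puts both measures on the same atoms: the definition uses roots of the characteristic
polynomial, independently of `D`. -/
theorem Eigendecomposition.spectralMeasure_eq {n : ℕ} {A : Matrix (Fin n) (Fin n) ℂ}
    (D : Eigendecomposition A) :
    spectralMeasure A = (n : ℝ≥0∞)⁻¹ • ∑ j, Measure.dirac (D.val j) := by
  have hroots : A.charpoly.roots = Finset.univ.val.map D.val := by
    rw [D.charpoly_eq, ← Polynomial.roots_multiset_prod_X_sub_C (Finset.univ.val.map D.val),
      Multiset.map_map]
    rfl
  rw [spectralMeasure, hroots, Multiset.map_map]
  rfl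

theorem Eigendecomposition.mulVec_vec {n : ℕ} {A : Matrix (Fin n) (Fin n) ℂ}
    (D : Eigendecomposition A) (k : Fin n) :
    Matrix.toEuclideanCLM (n := Fin n) (𝕜 := ℂ) A (D.vec k) = D.val k • D.vec k := by
  have hdot : ∀ j, star (D.vec j).ofLp ⬝ᵥ (D.vec k).ofLp = if j = k then 1 else 0 := by
    intro j
    have := orthonormal_iff_ite.mp D.vec.orthonormal j k
    rwa [EuclideanSpace.inner_eq_star_dotProduct, dotProduct_comm] at this
  have h : A *ᵥ (D.vec k).ofLp = D.val k • (D.vec k).ofLp := by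
    refine (congrArg (· *ᵥ (D.vec k).ofLp) D.eq_sum).trans ?_
    ext i
    simp [Matrix.sum_mulVec, Matrix.smul_mulVec, Matrix.vecMulVec_mulVec, hdot, ite_apply]
  ext i
  simpa using congrFun h i

theorem Eigendecomposition.norm_val_le {n : ℕ} {A : Matrix (Fin n) (Fin n) ℂ}
    (D : Eigendecomposition A) (k : Fin n) :
    ‖D.val k‖ ≤ ‖Matrix.toEuclideanCLM (n := Fin n) (𝕜 := ℂ) A‖ := by
  have h := (Matrix.toEuclideanCLM (n := Fin n) (𝕜 := ℂ) A).le_opNorm (D.vec k)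
  rwa [D.mulVec_vec, norm_smul, D.vec.norm_eq_one, mul_one, mul_one] at h

theorem Eigendecomposition.chebMoment_spectralMeasure {n : ℕ} {A : Matrix (Fin n) (Fin n) ℂ}
    (D : Eigendecomposition A) (j k : ℕ) :
    chebMoment (spectralMeasure A) j k =
      (n : ℝ)⁻¹ * ∑ i, chebT j (D.val i).re * chebT k (D.val i).im := by
  rw [chebMoment, D.spectralMeasure_eq, integral_smul_measure, integral_finsetSum_measure]
  · simp
  · exact fun i _ => integrable_dirac enorm_lt_top

theorem Eigendecomposition.chebMoment_weightedMeasure {n : ℕ} {A : Matrix (Fin n) (Fin n) ℂ}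
    (D : Eigendecomposition A) (b : CVec n) (j k : ℕ) :
    chebMoment (D.weightedMeasure b) j k =
      ∑ i, chebT j (D.val i).re * chebT k (D.val i).im * ‖inner ℂ b (D.vec i)‖ ^ 2 := by
  rw [chebMoment, Eigendecomposition.weightedMeasure, integral_finsetSum_measure]
  · refine Finset.sum_congr rfl fun i _ => ?_
    rw [integral_smul_measure, integral_dirac, ENNReal.toReal_ofReal (by positivity),
      smul_eq_mul, mul_comm]
  · exact fun i _ => (integrable_dirac enorm_lt_top).smul_measure ENNReal.ofReal_ne_top

theorem abs_chebT_le (j : ℕ) {x : ℝ} (hx : |x| ≤ 1) : |chebT j x| ≤ √(2 / Real.pi) := by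
  rw [chebT]
  split_ifs
  · rw [abs_of_nonneg (by positivity), Real.sqrt_div (by norm_num)]
    gcongr
    exact Real.one_le_sqrt.2 (by norm_num)
  · rw [abs_mul, abs_of_nonneg (by positivity)]
    exact mul_le_of_le_one_right (by positivity)
      (Polynomial.Chebyshev.abs_eval_T_real_le_one j hx)

theorem abs_chebT_mul_chebT_le (j k : ℕ) {z : ℂ} (hz : ‖z‖ ≤ 1) :
    |chebT j z.re * chebT k z.im| ≤ 2 / Real.pi := by
  rw [abs_mul, ← Real.mul_self_sqrt (show 0 ≤ 2 / Real.pi by positivity)]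
  exact mul_le_mul (abs_chebT_le j ((Complex.abs_re_le_norm z).trans hz))
    (abs_chebT_le k ((Complex.abs_im_le_norm z).trans hz)) (abs_nonneg _) (by positivity)

/-! ### Gaussian integrals -/

theorem integrable_exp_neg_mul_norm_sq {V : Type*} [NormedAddCommGroup V]
    [InnerProductSpace ℝ V] [FiniteDimensional ℝ V] [MeasurableSpace V] [BorelSpace V]
    {b : ℝ} (hb : 0 < b) : Integrable fun z : V => Real.exp (-b * ‖z‖ ^ 2) := by
  -- A non-integrable function has integral 0 by convention, but the Gaussian formula is positive.
  by_contra h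
  have h1 := GaussianFourier.integral_rexp_neg_mul_sq_norm (V := V) hb
  rw [integral_undef h] at h1
  exact absurd h1 (by positivity)

theorem lintegral_exp_neg_norm_sq (V : Type*) [NormedAddCommGroup V]
    [InnerProductSpace ℝ V] [FiniteDimensional ℝ V] [MeasurableSpace V] [BorelSpace V] :
    ∫⁻ x : V, ENNReal.ofReal (Real.exp (-‖x‖ ^ 2)) =
      ENNReal.ofReal (Real.pi ^ (Module.finrank ℝ V / 2 : ℝ)) := by
  have h := GaussianFourier.integral_rexp_neg_mul_sq_norm (V := V) one_pos
  have hi := integrable_exp_neg_mul_norm_sq (V := V) one_pos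
  simp only [neg_mul, one_mul, div_one] at h hi
  rw [← h, ofReal_integral_eq_lintegral_ofReal hi (ae_of_all _ fun x => (Real.exp_pos _).le)]

theorem lintegral_exp_neg_sum_mul_norm_sq {ι : Type*} [Fintype ι] {b : ι → ℝ}
    (hb : ∀ i, 0 < b i) :
    ∫⁻ z : ι → ℂ, ENNReal.ofReal (Real.exp (-∑ i, b i * ‖z i‖ ^ 2)) =
      ENNReal.ofReal (∏ i, Real.pi / b i) := by
  have hprod : ∀ z : ι → ℂ, Real.exp (-∑ i, b i * ‖z i‖ ^ 2) =
      ∏ i, Real.exp (-b i * ‖z i‖ ^ 2) := fun z => by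
    simp [← Real.exp_sum, ← Finset.sum_neg_distrib]
  simp_rw [hprod]
  rw [volume_pi, ← ofReal_integral_eq_lintegral_ofReal
      (Integrable.fintype_prod (f := fun i (z : ℂ) => Real.exp (-b i * ‖z‖ ^ 2))
        fun i => integrable_exp_neg_mul_norm_sq (hb i))
      (ae_of_all _ fun z => Finset.prod_nonneg fun i _ => (Real.exp_pos _).le),
    integral_fintype_prod_eq_prod (fun i (z : ℂ) => Real.exp (-b i * ‖z‖ ^ 2))]
  congr 1
  refine Finset.prod_congr rfl fun i _ => ?_
  rw [GaussianFourier.integral_rexp_neg_mul_sq_norm (hb i)]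
  simp

/-- In the coordinates of an orthonormal basis, an anisotropic complex Gaussian integral is the
isotropic one divided by the product of the coefficients. -/
theorem lintegral_exp_neg_sum_mul_inner_sq {n : ℕ} (v : OrthonormalBasis (Fin n) ℂ (CVec n))
    {b : Fin n → ℝ} (hb : ∀ i, 0 < b i) :
    ∫⁻ x : CVec n, ENNReal.ofReal (Real.exp (-∑ i, b i * ‖inner ℂ x (v i)‖ ^ 2)) =
      ENNReal.ofReal (∏ i, (b i)⁻¹) *
        ∫⁻ x : CVec n, ENNReal.ofReal (Real.exp (-‖x‖ ^ 2)) := by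
  let e : CVec n ≃L[ℝ] (Fin n → ℂ) :=
    ((v.repr.toLinearEquiv.trans
      (WithLp.linearEquiv 2 ℂ (Fin n → ℂ))).restrictScalars ℝ).toContinuousLinearEquiv
  have he : ∀ x i, ‖inner ℂ x (v i)‖ = ‖e x i‖ := fun x i => by
    rw [norm_inner_symm]; simp [e, v.repr_apply_apply]
  have hnorm : ∀ x : CVec n, ‖x‖ ^ 2 = ∑ i, (1 : ℝ) * ‖inner ℂ x (v i)‖ ^ 2 := fun x => by
    simp [v.sum_sq_norm_inner_left]
  have : (Measure.map e (volume : Measure (CVec n))).IsAddHaarMeasure :=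
    e.isAddHaarMeasure_map _
  -- The value of κ is irrelevant: it enters both integrals as the same factor.
  obtain ⟨κ, hκ⟩ : ∃ κ : ℝ≥0∞, Measure.map e (volume : Measure (CVec n)) = κ • volume :=
    ⟨_, Measure.isAddLeftInvariant_eq_smul _ _⟩
  have key : ∀ {c : Fin n → ℝ}, (∀ i, 0 < c i) →
      ∫⁻ x : CVec n, ENNReal.ofReal (Real.exp (-∑ i, c i * ‖inner ℂ x (v i)‖ ^ 2)) =
        κ * ENNReal.ofReal (∏ i, Real.pi / c i) := by
    intro c hc
    simp_rw [he]
    rw [← lintegral_exp_neg_sum_mul_norm_sq hc, ← smul_eq_mul, ← lintegral_smul_measure, ← hκ,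
      lintegral_map (by fun_prop) e.continuous.measurable]
  simp_rw [hnorm]
  rw [key hb, key fun _ => one_pos, mul_left_comm, ← ENNReal.ofReal_mul
    (Finset.prod_nonneg fun i _ => (inv_pos.2 (hb i)).le), ← Finset.prod_mul_distrib]
  simp [div_eq_inv_mul]

/-! ### From Gaussian integrals to the sphere -/

/-- Polar coordinates for a radial weight. -/
theorem lintegral_polar {n : ℕ} {s : Set (CSphere n)} (hs : MeasurableSet s)
    {g : ℝ → ℝ≥0∞} (hg : Measurable g) :
    ∫⁻ x : ({0}ᶜ : Set (CVec n)),
        s.indicator 1 (homeomorphUnitSphereProd (CVec n) x).1 * g ‖(x : CVec n)‖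
          ∂(volume.comap Subtype.val) =
      (volume : Measure (CVec n)).toSphere s *
        ∫⁻ r : Set.Ioi (0 : ℝ), g r ∂(.volumeIoiPow (Module.finrank ℝ (CVec n) - 1)) := by
  have h := (volume : Measure (CVec n)).measurePreserving_homeomorphUnitSphereProd
  have h1 : Measurable (s.indicator (1 : CSphere n → ℝ≥0∞)) := measurable_one.indicator hs
  have h2 : Measurable fun r : Set.Ioi (0 : ℝ) => g r := hg.comp measurable_subtype_coe
  rw [← lintegral_indicator_one hs, ← lintegral_prod_mul h1.aemeasurable h2.aemeasurable,
    ← h.lintegral_comp (by fun_prop)]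
  simp

/-- The uniform measure of a set is at most `R` if a Gaussian integral over the cone spanned by
the set is at most `R` times the full one. -/
theorem uniformSphere_le_of_gaussian {n : ℕ} (hn : 1 ≤ n) {s : Set (CSphere n)}
    (hs : MeasurableSet s) {F : CVec n → ℝ≥0∞} {R : ℝ≥0∞}
    (hF : ∀ b ∈ s, ∀ r : ℝ, 0 < r → ENNReal.ofReal (Real.exp (-r ^ 2)) ≤ F (r • (b : CVec n)))
    (hR : ∫⁻ x, F x ≤ R * ∫⁻ x : CVec n, ENNReal.ofReal (Real.exp (-‖x‖ ^ 2))) :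
    uniformSphere n s ≤ R := by
  have : NeZero n := ⟨by omega⟩
  set S := (volume : Measure (CVec n)).toSphere
  set g : ℝ → ℝ≥0∞ := fun r => ENNReal.ofReal (Real.exp (-r ^ 2))
  have hg : Measurable g := by fun_prop
  set K := ∫⁻ r : Set.Ioi (0 : ℝ), g r ∂(.volumeIoiPow (Module.finrank ℝ (CVec n) - 1))
  have hcompl : ∀ f : CVec n → ℝ≥0∞, ∫⁻ x : ({0}ᶜ : Set (CVec n)), f x
      ∂(volume.comap Subtype.val) = ∫⁻ x, f x := fun f => by
    rw [lintegral_subtype_comap (measurableSet_singleton 0).compl, restrict_compl_singleton]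
  have htot : ∫⁻ x : CVec n, g ‖x‖ = S Set.univ * K := by
    rw [← lintegral_polar MeasurableSet.univ hg, ← hcompl]
    simp
  have hle : S s * K ≤ ∫⁻ x, F x := by
    rw [← lintegral_polar hs hg, ← hcompl]
    refine lintegral_mono fun x => ?_
    by_cases hx : (homeomorphUnitSphereProd (CVec n) x).1 ∈ s
    · have hx0 : (x : CVec n) ≠ 0 := x.2
      have := hF _ hx ‖(x : CVec n)‖ (norm_pos_iff.2 hx0)
      simpa [hx, smul_smul, hx0] using this
    · simp [hx]
  have hT : ∫⁻ x : CVec n, g ‖x‖ = ENNReal.ofReal _ := lintegral_exp_neg_norm_sq (CVec n)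
  have hT0 : S Set.univ * K ≠ 0 := by
    rw [← htot, hT]
    exact (ENNReal.ofReal_pos.2 (by positivity)).ne'
  have hT1 : S Set.univ * K ≠ ∞ := by
    rw [← htot, hT]
    exact ENNReal.ofReal_ne_top
  have hS0 := left_ne_zero_of_mul hT0
  have hK0 := right_ne_zero_of_mul hT0
  have hK1 : K ≠ ∞ := fun h => hT1 (by rw [h, ENNReal.mul_top hS0])
  have h : S s * K ≤ R * S Set.univ * K := by
    rw [mul_assoc, ← htot]
    exact hle.trans hR
  have h' := (ENNReal.mul_le_mul_iff_left hK0 hK1).1 h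
  change (S Set.univ)⁻¹ * S s ≤ R
  rw [mul_comm, ← div_eq_mul_inv]
  exact ENNReal.div_le_of_le_mul h'

/-! ### Chernoff bound -/

theorem inv_one_sub_le_exp {u : ℝ} (hu : u ≤ 1 / 2) : (1 - u)⁻¹ ≤ Real.exp (u + u ^ 2) := by
  rw [inv_le_iff_one_le_mul₀' (by linarith)]
  rcases le_total u 0 with h | h
  · have := Real.add_one_le_exp (u + u ^ 2)
    have h3 : 0 ≤ -u * u ^ 2 := mul_nonneg (by linarith) (sq_nonneg u)
    nlinarith
  · have h1 := Real.quadratic_le_exp_of_nonneg (show 0 ≤ u + u ^ 2 by positivity)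
    -- With s = u + u², this is twice (1 - u)(1 + s + s²/2) - 1; the second factor is still 1/8 at u
    -- = 1/2.
    have h2 : 0 ≤ u ^ 2 * (1 - u - u ^ 2 - u ^ 3) := by
      refine mul_nonneg (sq_nonneg u) ?_
      nlinarith [pow_le_pow_left₀ h hu 2, pow_le_pow_left₀ h hu 3]
    nlinarith

/-- The linear terms cancel because ∑ yᵢ = 0. The Chernoff parameter 3ε/10 leaves the exponent at
most (-0.3 + 0.09 · 0.41)nε² < -nε²/4, and 0.3 · 1.28² < 1/2 keeps every factor in the range of
`inv_one_sub_le_exp`. -/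
theorem prod_div_one_sub_le_exp {n : ℕ} {y : Fin n → ℝ} {ε : ℝ} (hε : 0 < ε)
    (hε' : ε ≤ 4 / Real.pi) (hy0 : ∑ i, y i = 0) (hy : ∀ i, y i ≤ 4 / Real.pi)
    (hy2 : ∑ i, y i ^ 2 ≤ n * (2 / Real.pi) ^ 2) :
    ∏ i, (1 - 3 / 10 * ε ^ 2) / (1 - 3 / 10 * ε * y i) ≤ Real.exp (-(n * ε ^ 2 / 4)) := by
  have hc : 4 / Real.pi ≤ 1.28 := by
    rw [div_le_iff₀ Real.pi_pos]; linarith [Real.pi_gt_d2]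
  have hc' : 2 / Real.pi ≤ 0.64 := by
    rw [div_le_iff₀ Real.pi_pos]; linarith [Real.pi_gt_d2]
  have hu : ∀ i, 3 / 10 * ε * y i ≤ 1 / 2 := fun i => by
    nlinarith [hy i, hε, hε']
  have h1 : 0 ≤ 1 - 3 / 10 * ε ^ 2 := by nlinarith
  calc ∏ i, (1 - 3 / 10 * ε ^ 2) / (1 - 3 / 10 * ε * y i)
      ≤ ∏ i, Real.exp (-(3 / 10 * ε ^ 2) + (3 / 10 * ε * y i + (3 / 10 * ε * y i) ^ 2)) := by
        refine Finset.prod_le_prod (fun i _ => div_nonneg h1 (by linarith [hu i])) fun i _ => ?_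
        rw [div_eq_mul_inv, Real.exp_add]
        exact mul_le_mul (Real.one_sub_le_exp_neg _) (inv_one_sub_le_exp (hu i))
          (inv_nonneg.2 (by linarith [hu i])) (Real.exp_pos _).le
    _ ≤ Real.exp (-(n * ε ^ 2 / 4)) := by
        rw [← Real.exp_sum, Real.exp_le_exp]
        simp_rw [mul_pow, Finset.sum_add_distrib, ← Finset.mul_sum, hy0]
        have h2 : (2 / Real.pi) ^ 2 ≤ 0.41 := by
          have : 0 ≤ 2 / Real.pi := by positivity
          nlinarith
        have h3 : 0 ≤ n * ε ^ 2 := by positivity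
        have h4 : ε ^ 2 * ∑ i, y i ^ 2 ≤ n * ε ^ 2 * 0.41 := by
          calc ε ^ 2 * ∑ i, y i ^ 2 ≤ ε ^ 2 * (n * (2 / Real.pi) ^ 2) := by gcongr
            _ ≤ ε ^ 2 * (n * 0.41) := by gcongr
            _ = _ := by ring
        simp only [Finset.sum_const, Finset.card_univ, Fintype.card_fin, nsmul_eq_mul]
        nlinarith

/-! ### Concentration on the sphere -/

theorem sum_sq_norm_inner_eq_one {n : ℕ} (v : OrthonormalBasis (Fin n) ℂ (CVec n))
    (b : CSphere n) : ∑ i, ‖inner ℂ (b : CVec n) (v i)‖ ^ 2 = 1 := by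
  rw [v.sum_sq_norm_inner_left, norm_eq_of_mem_sphere, one_pow]

theorem measurable_sum_mul_sq_norm_inner {n : ℕ} (v : OrthonormalBasis (Fin n) ℂ (CVec n))
    (a : Fin n → ℝ) :
    Measurable fun b : CSphere n => ∑ i, a i * ‖inner ℂ (b : CVec n) (v i)‖ ^ 2 := by
  refine Continuous.measurable ?_
  fun_prop

/-- A quadratic form with eigenvalues in `[-2/π, 2/π]` exceeds its mean by `ε` on the unit sphere
of `ℂⁿ` with probability at most `exp (-n ε² / 4)`. -/
theorem uniformSphere_upper_tail {n : ℕ} (hn : 1 ≤ n) (v : OrthonormalBasis (Fin n) ℂ (CVec n))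
    {a : Fin n → ℝ} (ha : ∀ i, |a i| ≤ 2 / Real.pi) {ε : ℝ} (hε : 0 < ε) :
    uniformSphere n {b | ε ≤ ∑ i, a i * ‖inner ℂ (b : CVec n) (v i)‖ ^ 2 - (n : ℝ)⁻¹ * ∑ i, a i} ≤
      ENNReal.ofReal (Real.exp (-(n * ε ^ 2 / 4))) := by
  have hn0 : (0 : ℝ) < n := by exact_mod_cast hn
  set M := (n : ℝ)⁻¹ * ∑ i, a i with hM
  have hsum : ∑ i, a i = n * M := by rw [hM, mul_inv_cancel_left₀ hn0.ne']
  have hM' : -(2 / Real.pi) ≤ M := by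
    have : ∑ i : Fin n, -(2 / Real.pi) ≤ ∑ i, a i :=
      Finset.sum_le_sum fun i _ => (abs_le.1 (ha i)).1
    rw [hsum] at this
    simp only [Finset.sum_const, Finset.card_univ, Fintype.card_fin, nsmul_eq_mul] at this
    exact le_of_mul_le_mul_left this hn0
  have h4 : 4 / Real.pi = 2 / Real.pi + 2 / Real.pi := by ring
  -- No deviation can exceed 4/π, the width of [-2/π, 2/π]; the bound on ε is needed for positivity
  -- of the βᵢ.
  rcases lt_or_ge (4 / Real.pi) ε with hlarge | hsmall
  · have hempty : {b : CSphere n | ε ≤ ∑ i, a i * ‖inner ℂ (b : CVec n) (v i)‖ ^ 2 - M} = ∅ := by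
      refine Set.eq_empty_of_forall_notMem fun b (hb : ε ≤ _) => ?_
      have : ∑ i, a i * ‖inner ℂ (b : CVec n) (v i)‖ ^ 2 ≤
          ∑ i, 2 / Real.pi * ‖inner ℂ (b : CVec n) (v i)‖ ^ 2 :=
        Finset.sum_le_sum fun i _ =>
          mul_le_mul_of_nonneg_right (abs_le.1 (ha i)).2 (sq_nonneg _)
      rw [← Finset.mul_sum, sum_sq_norm_inner_eq_one, mul_one] at this
      linarith
    rw [hempty, measure_empty]
    exact zero_le
  · set y : Fin n → ℝ := fun i => a i - M
    have hy : ∀ i, y i ≤ 4 / Real.pi := fun i => by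
      have := (abs_le.1 (ha i)).2
      simp only [y]
      linarith
    have hy0 : ∑ i, y i = 0 := by
      simp [y, hsum]
    have hy2 : ∑ i, y i ^ 2 ≤ n * (2 / Real.pi) ^ 2 := by
      have h1 : ∑ i, y i ^ 2 = ∑ i, a i ^ 2 - n * M ^ 2 := by
        simp only [y, sub_sq, Finset.sum_add_distrib, Finset.sum_sub_distrib, ← Finset.sum_mul,
          ← Finset.mul_sum, hsum]
        simp only [Finset.sum_const, Finset.card_univ, Fintype.card_fin, nsmul_eq_mul]
        ring
      have h2 : ∑ i, a i ^ 2 ≤ ∑ i : Fin n, (2 / Real.pi) ^ 2 :=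
        Finset.sum_le_sum fun i _ => sq_le_sq' (abs_le.1 (ha i)).1 (abs_le.1 (ha i)).2
      simp only [Finset.sum_const, Finset.card_univ, Fintype.card_fin, nsmul_eq_mul] at h2
      have : 0 ≤ n * M ^ 2 := by positivity
      linarith
    have hc : 4 / Real.pi ≤ 1.28 := by
      rw [div_le_iff₀ Real.pi_pos]; linarith [Real.pi_gt_d2]
    have hd : 0 < 1 - 3 / 10 * ε ^ 2 := by nlinarith
    have hu : ∀ i, 0 < 1 - 3 / 10 * ε * y i := fun i => by nlinarith [hy i]
    -- Chosen so that ∑ wᵢ = 1 and ∑ yᵢwᵢ ≥ ε force ∑ βᵢwᵢ ≤ 1.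
    set β : Fin n → ℝ := fun i => (1 - 3 / 10 * ε * y i) / (1 - 3 / 10 * ε ^ 2)
    have hβ : ∀ i, 0 < β i := fun i => div_pos (hu i) hd
    refine uniformSphere_le_of_gaussian hn
      (measurableSet_le measurable_const
        ((measurable_sum_mul_sq_norm_inner v a).sub measurable_const))
      (F := fun x => ENNReal.ofReal (Real.exp (-∑ i, β i * ‖inner ℂ x (v i)‖ ^ 2))) ?_ ?_
    · intro b (hb : ε ≤ ∑ i, a i * ‖inner ℂ (b : CVec n) (v i)‖ ^ 2 - M) r _
      refine ENNReal.ofReal_le_ofReal (Real.exp_le_exp.2 (neg_le_neg ?_))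
      have hw := sum_sq_norm_inner_eq_one v b
      have hβw : ∑ i, β i * ‖inner ℂ (b : CVec n) (v i)‖ ^ 2 ≤ 1 := by
        have hβ' : ∀ i, β i * ‖inner ℂ (b : CVec n) (v i)‖ ^ 2 =
            (1 - 3 / 10 * ε * y i) * ‖inner ℂ (b : CVec n) (v i)‖ ^ 2 / (1 - 3 / 10 * ε ^ 2) :=
          fun i => div_mul_eq_mul_div _ _ _
        simp_rw [hβ']
        rw [← Finset.sum_div, div_le_one hd]
        simp only [y, sub_mul, mul_sub, mul_assoc, one_mul, Finset.sum_sub_distrib,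
          ← Finset.mul_sum, hw]
        nlinarith
      have hsm : ∀ i, ‖inner ℂ (r • (b : CVec n)) (v i)‖ ^ 2 =
          r ^ 2 * ‖inner ℂ (b : CVec n) (v i)‖ ^ 2 := fun i => by
        rw [← Complex.coe_smul, inner_smul_left]
        simp [mul_pow]
      simp_rw [hsm, mul_left_comm _ (r ^ 2), ← Finset.mul_sum]
      exact mul_le_of_le_one_right (sq_nonneg r) hβw
    · rw [lintegral_exp_neg_sum_mul_inner_sq v hβ]
      gcongr
      simp only [β, inv_div]
      exact prod_div_one_sub_le_exp hε hsmall hy0 hy hy2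

theorem uniformSphere_abs_tail {n : ℕ} (hn : 1 ≤ n) (v : OrthonormalBasis (Fin n) ℂ (CVec n))
    {a : Fin n → ℝ} (ha : ∀ i, |a i| ≤ 2 / Real.pi) {ε : ℝ} (hε : 0 < ε) :
    uniformSphere n
        {b | ε ≤ |(n : ℝ)⁻¹ * ∑ i, a i - ∑ i, a i * ‖inner ℂ (b : CVec n) (v i)‖ ^ 2|} ≤
      2 * ENNReal.ofReal (Real.exp (-(n * ε ^ 2 / 4))) := by
  have h1 := uniformSphere_upper_tail hn v ha hε
  have h2 := uniformSphere_upper_tail hn v (a := fun i => -a i) (by simpa using ha) hε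
  rw [two_mul]
  refine (measure_mono fun b (hb : ε ≤ |_|) => ?_).trans
    ((measure_union_le _ _).trans (add_le_add h1 h2))
  rcases le_abs.1 hb with h | h
  · right
    simp only [Set.mem_ofPred_eq, neg_mul, Finset.sum_neg_distrib]
    linarith
  · left
    simp only [Set.mem_ofPred_eq]
    linarith

/-! ### Union bound over the moment indices -/

theorem card_momentIndices (m : ℕ) : (momentIndices m).card = (m + 1) ^ 2 - 1 := by
  rw [momentIndices, Finset.card_erase_of_mem (by simp), Finset.card_product, Finset.card_range,
    sq]

/-- The exponent is -(2n/(2n-1)) log q, and 2n/(2n-1) ≥ 1. -/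
theorem exp_neg_le_div {n : ℕ} (hn : 1 ≤ n) {q : ℝ} (hq : 1 ≤ q) :
    Real.exp (-(n * √(8 / (2 * (n : ℝ) - 1) * Real.log q) ^ 2 / 4)) ≤ q⁻¹ := by
  have hn1 : (1 : ℝ) ≤ n := by exact_mod_cast hn
  have hpos : 0 < 2 * (n : ℝ) - 1 := by linarith
  have hlog := Real.log_nonneg hq
  rw [Real.sq_sqrt (by positivity), ← Real.exp_log (inv_pos.2 (one_pos.trans_le hq)),
    Real.log_inv, Real.exp_le_exp, neg_le_neg_iff]
  have : n * (8 / (2 * (n : ℝ) - 1) * Real.log q) / 4 =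
      Real.log q + Real.log q / (2 * (n : ℝ) - 1) := by
    linear_combination Real.log q * mul_inv_cancel₀ hpos.ne'
  rw [this]
  exact le_add_of_nonneg_right (by positivity)

end SpectralDensity

open SpectralDensity

theorem mainTheorem6 {n m : ℕ} (hn : 1 ≤ n) (hm : 1 ≤ m)
    (A : Matrix (Fin n) (Fin n) ℂ) (hA : IsStarNormal A)
    (hA_norm : ‖Matrix.toEuclideanCLM (n := Fin n) (𝕜 := ℂ) A‖ ≤ 1)
    (D : SpectralDensity.Eigendecomposition A)
    {Ω : Type*} [MeasurableSpace Ω] (P : Measure Ω) [IsProbabilityMeasure P]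
    (b : Ω → SpectralDensity.CSphere n)
    (hb : HasLaw b (SpectralDensity.uniformSphere n) P)
    (δ : ℝ) (hδ0 : 0 < δ) (hδ1 : δ < 1) :
    P {ω | √(8 / (2 * (n : ℝ) - 1) * Real.log ((2 * ((m : ℝ) + 1) ^ 2 - 2) / δ)) ≤
        SpectralDensity.maxMomentDiff hm (SpectralDensity.spectralMeasure A)
          (D.weightedMeasure (b ω))} ≤ ENNReal.ofReal δ := by
  have hm1 : (1 : ℝ) ≤ m := by exact_mod_cast hm
  have hn1 : (1 : ℝ) ≤ n := by exact_mod_cast hn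
  set N : ℝ := ((m : ℝ) + 1) ^ 2 - 1 with hN
  have hN1 : 1 ≤ N := by nlinarith
  have hcard : ((momentIndices m).card : ℝ) = N := by
    rw [card_momentIndices, Nat.cast_sub (Nat.one_le_pow _ _ (by omega))]
    push_cast
    rfl
  rw [show 2 * ((m : ℝ) + 1) ^ 2 - 2 = 2 * N by rw [hN]; ring]
  have hq : 1 < 2 * N / δ := by
    rw [one_lt_div hδ0]
    linarith
  set ε := √(8 / (2 * (n : ℝ) - 1) * Real.log (2 * N / δ)) with hε_def
  have hε : 0 < ε := by
    have := Real.log_pos hq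
    have : 0 < 2 * (n : ℝ) - 1 := by linarith
    positivity
  let a : ℕ × ℕ → Fin n → ℝ := fun p i => chebT p.1 (D.val i).re * chebT p.2 (D.val i).im
  let E : ℕ × ℕ → Set (CSphere n) := fun p =>
    {b | ε ≤ |(n : ℝ)⁻¹ * ∑ i, a p i - ∑ i, a p i * ‖inner ℂ (b : CVec n) (D.vec i)‖ ^ 2|}
  have hE_meas : ∀ p, MeasurableSet (E p) := fun p =>
    measurableSet_le measurable_const
      (measurable_const.sub (measurable_sum_mul_sq_norm_inner D.vec (a p))).abs
  have hE : ∀ p, uniformSphere n (E p) ≤ ENNReal.ofReal (δ / N) := fun p => by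
    refine (uniformSphere_abs_tail hn D.vec (fun i => abs_chebT_mul_chebT_le p.1 p.2
      ((D.norm_val_le i).trans hA_norm)) hε).trans ?_
    rw [← ENNReal.ofReal_ofNat 2, ← ENNReal.ofReal_mul (by norm_num)]
    refine ENNReal.ofReal_le_ofReal ?_
    calc 2 * Real.exp (-(n * ε ^ 2 / 4)) ≤ 2 * (2 * N / δ)⁻¹ := by
          gcongr
          exact exp_neg_le_div hn hq.le
      _ = δ / N := by field_simp
  have hset : {ω | ε ≤ maxMomentDiff hm (spectralMeasure A) (D.weightedMeasure (b ω))} ⊆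
      b ⁻¹' ⋃ p ∈ momentIndices m, E p := by
    intro ω hω
    simp only [Set.mem_ofPred_eq, maxMomentDiff, Finset.le_sup'_iff,
      D.chebMoment_spectralMeasure, D.chebMoment_weightedMeasure] at hω
    obtain ⟨p, hp, h⟩ := hω
    simp only [Set.mem_preimage, Set.mem_iUnion]
    exact ⟨p, hp, h⟩
  calc _ ≤ P (b ⁻¹' ⋃ p ∈ momentIndices m, E p) := measure_mono hset
    _ = uniformSphere n (⋃ p ∈ momentIndices m, E p) := by
        rw [← hb.map_eq, Measure.map_apply_of_aemeasurable hb.aemeasurable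
          (Finset.measurableSet_biUnion _ fun p _ => hE_meas p)]
    _ ≤ ∑ p ∈ momentIndices m, uniformSphere n (E p) := measure_biUnion_finset_le _ _
    _ ≤ ∑ p ∈ momentIndices m, ENNReal.ofReal (δ / N) := Finset.sum_le_sum fun p _ => hE p
    _ = ENNReal.ofReal δ := by
        rw [Finset.sum_const, nsmul_eq_mul, ← ENNReal.ofReal_natCast, hcard,
          ← ENNReal.ofReal_mul (by linarith), mul_div_cancel₀ _ (by linarith)]
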